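/- **Setting.** An abstract state space $(A,\Omega,u)$ consists of a finite-dimensional real vector space $A$, a nonempty compact convex set $\Omega\subset A$ (the states) such that $A_+:=\mathbb R_{\ge 0}\,\Omega$ is a closed generating cone, and a linear functional $u$ with $u(x)>0$ for all $0\ne x\in A_+$ and, for $x\in A_+$, $u(x)=1\iff x\in\Omega$. Effects are linear functionals $e$ with $0\le e\le u$ on $A_+$. A transformation is a linear map $T:A\to A$ with $T(A_+)\subset A_+$ and $u\circ T\le u$ on $A_+$; an operation is a finite family of transformations $T_1,\dots,T_m$ with $\sum_a u\circ T_a=u$. Also given are a set of allowed effects, which is convex, closed, of full dimension, and closed under $e\mapsto u-e$ and under sums $e+f\le u$, and a group $\mathcal G$ of (allowed) reversible transformations, i.e. transformations whose inverses are transformations; $e\circ T$ is allowed whenever $e$ is allowed and $T\in\mathcal G$. Pure states are the extreme points of $\Omega$. States $w_1,\dots,w_n$ are perfectly distinguishable if there are allowed effects $e_1,\dots,e_n$ with $\sum_j e_j\le u$ and $e_j(w_k)=\delta_{jk}$. A classical decomposition of a state $w$ is an expression $w=\sum_{j=1}^n p_jw_j$ with $(p_j)$ a probability distribution and $w_1,\dots,w_n$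 perfectly distinguishable pure states. **Postulate 1 (classical decomposability).** Every state has a classical decomposition. **Postulate 2 (strong symmetry).** If $w_1,\dots,w_n$ and $v_1,\dots,v_n$ are two families of perfectly distinguishable pure states, then there is $T\in\mathcal G$ with $Tw_j=v_j$ for all $j$. **Theorem.** Assume Postulates 1 and 2. Then there is an inner product $\langle\cdot,\cdot\rangle$ on $A$ with the following properties: the functionals that are nonnegative on $A_+$ are exactly the $\langle w,\cdot\rangle$ with $w\in A_+$; $\langle Tx,Ty\rangle=\langle x,y\rangle$ for all $T\in\mathcal G$; $0\le\langle w,v\rangle\le 1$ for all states $w,v$; $\langle w,w\rangle=1$ for pure states $w$ and $\langle w,w\rangle<1$ for all other states; $\langle w,v\rangle=0$ if $w,v$ are perfectly distinguishable. Moreover, for every such inner product the following holds. Let $F_1,\dots,F_m$ be faces of $A_+$ and let $P_a$ be the projector onto the linear span of $F_a$ that is symmetric with respect to $\langle\cdot,\cdot\rangle$. If $P_1,\dots,P_m$ form an operation, then for every state $w$ the post-measurement ensemble state $w'=\sum_a P_aw$ is a state, the entropies $S(w)$ and $S(w')$ are well defined, where $S(v):=-\sum_j p_j\ln p_j$ (with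 $0\ln 0:=0$) for any classical decomposition $v=\sum_j p_jv_j$, independently of its choice, and $$S(w')\ge S(w).$$ -/

import Mathlib

noncomputable section

namespace GPT

/-- A face of a convex set `C`: a nonempty convex subset `F` of `C` such that whenever a point of
`F` lies strictly between two points of `C`, both of these points belong to `F`. -/
def IsFace {A : Type*} [AddCommGroup A] [Module ℝ A] (C F : Set A) : Prop :=
  F.Nonempty ∧ Convex ℝ F ∧ IsExtreme ℝ C F

/-- The set `ℝ_{≥0} · Ω`. -/
def rayCone {A : Type*} [AddCommGroup A] [Module ℝ A] (Ω : Set A) : Set A :=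
  {x | ∃ r : ℝ, 0 ≤ r ∧ ∃ w ∈ Ω, x = r • w}

/-- An abstract state space `(A, Ω, u)`. The norm of `A` is only used for the (unique) vector space
topology of the finite-dimensional space `A`. That `ℝ_{≥0} · Ω` is closed under addition and
contains no line follows from `convex` and `unit_pos`. -/
structure AbstractStateSpace (A : Type*) [NormedAddCommGroup A] [NormedSpace ℝ A] where
  /-- the normalized states -/
  states : Set A
  /-- the order unit -/
  unit : Module.Dual ℝ A
  nonempty : states.Nonempty
  convex : Convex ℝ states
  compact : IsCompact states
  cone_closed : IsClosed (rayCone states)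
  cone_generating : Submodule.span ℝ (rayCone states) = ⊤
  unit_pos : ∀ x ∈ rayCone states, x ≠ 0 → 0 < unit x
  unit_eq_one_iff : ∀ x ∈ rayCone states, unit x = 1 ↔ x ∈ states

namespace AbstractStateSpace

variable {A : Type*} [NormedAddCommGroup A] [NormedSpace ℝ A]

/-- The cone `A₊` of unnormalized states. -/
def cone (S : AbstractStateSpace A) : Set A := rayCone S.states

/-- The pure states: the extreme points of the set of states. -/
def pureStates (S : AbstractStateSpace A) : Set A := S.states.extremePoints ℝ

/-- The set of all (mathematically possible) effects. -/
def effects (S : AbstractStateSpace A) : Set (Module.Dual ℝ A) :=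
  {e | ∀ x ∈ S.cone, 0 ≤ e x ∧ e x ≤ S.unit x}

/-- A transformation of the system: a positive, normalization-non-increasing linear map. -/
def IsTransformation (S : AbstractStateSpace A) (T : A →ₗ[ℝ] A) : Prop :=
  (∀ x ∈ S.cone, T x ∈ S.cone) ∧ ∀ x ∈ S.cone, S.unit (T x) ≤ S.unit x

/-- An operation: finitely many transformations `T a` with `∑ a, u ∘ T a = u`. -/
def IsOperation (S : AbstractStateSpace A) {m : ℕ} (T : Fin m → A →ₗ[ℝ] A) : Prop :=
  (∀ a, S.IsTransformation (T a)) ∧ ∑ a, S.unit ∘ₗ T a = S.unit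

end AbstractStateSpace

/-- A dynamical state space: an abstract state space with a set of physically allowed effects and
a group of physically allowed reversible transformations. -/
structure DynamicalStateSpace (A : Type*) [NormedAddCommGroup A] [NormedSpace ℝ A]
    extends AbstractStateSpace A where
  /-- the allowed effects -/
  allowed : Set (Module.Dual ℝ A)
  /-- the allowed reversible transformations -/
  group : Subgroup (A ≃ₗ[ℝ] A)
  allowed_subset : allowed ⊆ toAbstractStateSpace.effects
  allowed_convex : Convex ℝ allowed
  /-- The allowed effects are closed for the topology of pointwise convergence, which is the
  vector space topology of the finite-dimensional dual space. -/
  allowed_closed : IsClosed ((fun (e : Module.Dual ℝ A) (x : A) => e x) '' allowed)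
  allowed_full : Submodule.span ℝ allowed = ⊤
  allowed_compl : ∀ e ∈ allowed, toAbstractStateSpace.unit - e ∈ allowed
  allowed_add : ∀ e ∈ allowed, ∀ f ∈ allowed,
    (∀ x ∈ toAbstractStateSpace.cone, e x + f x ≤ toAbstractStateSpace.unit x) → e + f ∈ allowed
  /-- Elements of the group are transformations; as the group contains inverses, so are
  their inverses. -/
  group_transformation : ∀ T ∈ group, toAbstractStateSpace.IsTransformation (T : A →ₗ[ℝ] A)
  allowed_comp : ∀ e ∈ allowed, ∀ T ∈ group, e ∘ₗ (T : A →ₗ[ℝ] A) ∈ allowed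

namespace DynamicalStateSpace

variable {A : Type*} [NormedAddCommGroup A] [NormedSpace ℝ A]

/-- States `w 0, …, w (n - 1)` are perfectly distinguishable if there are allowed effects `e j`
with `∑ j, e j ≤ u` and `e j (w k) = δ_{jk}`. -/
def PerfectlyDistinguishable (S : DynamicalStateSpace A) {n : ℕ} (w : Fin n → A) : Prop :=
  (∀ j, w j ∈ S.states) ∧
    ∃ e : Fin n → Module.Dual ℝ A, (∀ j, e j ∈ S.allowed) ∧
      (∀ x ∈ S.cone, ∑ j, e j x ≤ S.unit x) ∧
      ∀ j k, e j (w k) = if j = k then 1 else 0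

/-- An `n`-frame: `n` perfectly distinguishable pure states. -/
def IsFrame (S : DynamicalStateSpace A) {n : ℕ} (w : Fin n → A) : Prop :=
  (∀ j, w j ∈ S.pureStates) ∧ S.PerfectlyDistinguishable w

/-- `w = ∑ j, p j • v j` is a classical decomposition of `w`: the `v j` are perfectly
distinguishable pure states and `p` is a probability distribution. -/
def IsClassicalDecomposition (S : DynamicalStateSpace A) (w : A) {n : ℕ}
    (p : Fin n → ℝ) (v : Fin n → A) : Prop :=
  (∀ j, 0 ≤ p j) ∧ ∑ j, p j = 1 ∧ S.IsFrame v ∧ w = ∑ j, p j • v j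

/-- Postulate 1, classical decomposability. -/
def ClassicalDecomposability (S : DynamicalStateSpace A) : Prop :=
  ∀ w ∈ S.states, ∃ (n : ℕ) (p : Fin n → ℝ) (v : Fin n → A), S.IsClassicalDecomposition w p v

/-- Postulate 2, strong symmetry. -/
def StrongSymmetry (S : DynamicalStateSpace A) : Prop :=
  ∀ (n : ℕ) (w v : Fin n → A), S.IsFrame w → S.IsFrame v → ∃ T ∈ S.group, ∀ j, T (w j) = v j

/-- `B` is a self-dualizing inner product on `A` which is invariant under the reversible
transformations and normalized on the pure states. -/
structure IsSelfDualizing (S : DynamicalStateSpace A) (B : LinearMap.BilinForm ℝ A) : Prop where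
  symm : ∀ x y, B x y = B y x
  posDef : ∀ x, x ≠ 0 → 0 < B x x
  /-- The dual cone of `A₊` consists of the functionals `⟨w, ·⟩` with `w ∈ A₊`. -/
  selfDual : {f : Module.Dual ℝ A | ∀ x ∈ S.cone, 0 ≤ f x} = {f | ∃ w ∈ S.cone, f = B w}
  invariant : ∀ T ∈ S.group, ∀ x y, B (T x) (T y) = B x y
  mem_unitInterval : ∀ w ∈ S.states, ∀ v ∈ S.states, 0 ≤ B w v ∧ B w v ≤ 1
  pure_eq_one : ∀ w ∈ S.pureStates, B w w = 1
  mixed_lt_one : ∀ w ∈ S.states, w ∉ S.pureStates → B w w < 1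
  distinguishable_orthogonal : ∀ w v, S.PerfectlyDistinguishable ![w, v] → B w v = 0

/-- The entropy of `w` is well defined and equal to `s`: there is a classical decomposition of `w`,
and `-∑ j, p j * log (p j) = s` for every classical decomposition `w = ∑ j, p j • v j`. -/
def HasEntropy (S : DynamicalStateSpace A) (w : A) (s : ℝ) : Prop :=
  (∃ (n : ℕ) (p : Fin n → ℝ) (v : Fin n → A), S.IsClassicalDecomposition w p v) ∧
    ∀ (n : ℕ) (p : Fin n → ℝ) (v : Fin n → A), S.IsClassicalDecomposition w p v →
      -∑ j, p j * Real.log (p j) = s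

end DynamicalStateSpace

/-- `P` is the projector onto the subspace `U` that is symmetric with respect to `B`. -/
def IsSymmetricProjectorOnto {A : Type*} [AddCommGroup A] [Module ℝ A]
    (B : LinearMap.BilinForm ℝ A) (P : A →ₗ[ℝ] A) (U : Submodule ℝ A) : Prop :=
  P ∘ₗ P = P ∧ (∀ x y, B (P x) y = B x (P y)) ∧ LinearMap.range P = U

end GPT

end

namespace GPT

open MeasureTheory

/-! Everything rests on inner products for which every frame is orthonormal (`IsFrameInner`).
Averaging over the polar of the state space gives some group-invariant inner product `b`, and its
shortest state `μ` is fixed by the group. Strong symmetry permutes the frame decomposing `μ`, so its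
weights are equal: maximal frames all have one size `N` and one sum `M = N • μ`, and every frame
extends to a maximal one (`exists_isFrameSum`). Subtracting a multiple of `u ⊗ u` from `b` and
rescaling makes frames orthonormal (`exists_isFrameInner`).

Orthonormality and spectral decompositions along maximal frames (`exists_spectral`) show that a pure
state represents an allowed effect (`mem_allowed`); self-duality follows.

For the entropy, take maximal frames `V`, `X` decomposing `w` and `w' = Φ w`, with `Φ = ∑ a, P a`.
The weights of `w'` arise from those of `w` through the matrix `B (X i) (Φ (V k))`. It is doubly
stochastic because `Φ` is positive, unit-preserving and symmetric, so concavity of `-t log t` gives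
the inequality (`sum_negMulLog_le`). The case `Φ = id` shows that entropy is well defined. -/

theorem AbstractStateSpace.states_subset_cone {A : Type*} [NormedAddCommGroup A]
    [NormedSpace ℝ A] (S : AbstractStateSpace A) : S.states ⊆ S.cone :=
  fun x hx => ⟨1, zero_le_one, x, hx, (one_smul ℝ x).symm⟩

theorem AbstractStateSpace.span_states {A : Type*} [NormedAddCommGroup A]
    [NormedSpace ℝ A] (S : AbstractStateSpace A) : Submodule.span ℝ S.states = ⊤ := by
  rw [eq_top_iff, ← S.cone_generating, Submodule.span_le]
  rintro _ ⟨r, -, w, hw, rfl⟩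
  exact Submodule.smul_mem _ _ (Submodule.subset_span hw)

/-! ### Invariant inner products from the polar of a bounded spanning set -/

section InvariantForm

variable {A : Type*} [NormedAddCommGroup A] [NormedSpace ℝ A]

/-- The absolute polar of a set. -/
def absPolar (K : Set A) : Set (A →L[ℝ] ℝ) := {φ | ∀ x ∈ K, |φ x| ≤ 1}

theorem isClosed_absPolar (K : Set A) : IsClosed (absPolar K) := by
  have : absPolar K = ⋂ x ∈ K, {φ : A →L[ℝ] ℝ | |φ x| ≤ 1} := by
    ext φ; simp [absPolar]
  rw [this]
  refine isClosed_biInter fun x _ => isClosed_le ?_ continuous_const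
  fun_prop

theorem absPolar_mem_nhds_zero {K : Set A} (hK : Bornology.IsBounded K) :
    absPolar K ∈ nhds (0 : A →L[ℝ] ℝ) := by
  obtain ⟨R, hR, hKR⟩ := hK.exists_pos_norm_le
  refine Filter.mem_of_superset (Metric.ball_mem_nhds 0 (inv_pos.2 hR)) fun φ hφ x hx => ?_
  rw [mem_ball_zero_iff] at hφ
  calc |φ x| = ‖φ x‖ := rfl
    _ ≤ ‖φ‖ * ‖x‖ := φ.le_opNorm x
    _ ≤ R⁻¹ * R := by gcongr; exact hKR x hx
    _ = 1 := inv_mul_cancel₀ hR.ne'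

variable [FiniteDimensional ℝ A]

/-- A basis chosen inside `K` gives every polar functional coordinates in `[-1, 1]`, so the polar is
closed in the image of a cube. -/
theorem isCompact_absPolar {K : Set A} (hK : Submodule.span ℝ K = ⊤) :
    IsCompact (absPolar K) := by
  obtain ⟨s, hsK, hspan, hli⟩ := exists_linearIndependent ℝ K
  rw [hK] at hspan
  let b : Module.Basis s ℝ A := Module.Basis.mk hli (by simp [hspan])
  have : Fintype s := FiniteDimensional.fintypeBasisIndex b
  let L : (s → ℝ) →ₗ[ℝ] (A →L[ℝ] ℝ) :=
    (LinearMap.toContinuousLinearMap (𝕜 := ℝ) (E := A) (F' := ℝ)).toLinearMap ∘ₗ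
      (b.constr ℝ).toLinearMap
  have hL : Continuous L := L.continuous_of_finiteDimensional
  refine ((isCompact_univ_pi fun _ : s => isCompact_Icc (a := (-1 : ℝ)) (b := 1)).image
    hL).of_isClosed_subset (isClosed_absPolar K) fun φ hφ => ?_
  refine ⟨fun i => φ (b i), fun i _ => ?_, ?_⟩
  · have hbi : b i = i := by simp [b]
    change φ (b i) ∈ Set.Icc (-1) 1
    rw [hbi]
    exact abs_le.1 (hφ i (hsK i.2))
  · apply ContinuousLinearMap.coe_injective
    refine b.ext fun i => ?_
    exact b.constr_basis ℝ _ i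

/-- A bounded spanning set has a positive definite symmetric bilinear form which is invariant under
every linear automorphism preserving the set. -/
theorem exists_invariant_bilinForm {K : Set A} (hKb : Bornology.IsBounded K)
    (hK : Submodule.span ℝ K = ⊤) :
    ∃ b : LinearMap.BilinForm ℝ A, (∀ x y, b x y = b y x) ∧ (∀ x, x ≠ 0 → 0 < b x x) ∧
      ∀ T : A ≃ₗ[ℝ] A, (∀ x, T x ∈ K ↔ x ∈ K) → ∀ x y, b (T x) (T y) = b x y := by
  have hcomp := isCompact_absPolar hK
  let ν : Measure (A →L[ℝ] ℝ) := Measure.addHaar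
  have hint (x y : A) : IntegrableOn (fun φ : A →L[ℝ] ℝ => φ x * φ y) (absPolar K) ν :=
    ContinuousOn.integrableOn_compact hcomp (by fun_prop)
  -- The second moment of the polar: its symmetries include those of `K`, so no integration over a
  -- group is needed.
  refine ⟨LinearMap.mk₂ ℝ (fun x y => ∫ φ in absPolar K, φ x * φ y ∂ν) ?_ ?_ ?_ ?_,
    ?_, ?_, ?_⟩
  · intro x x' y
    rw [← integral_add (hint x y) (hint x' y)]
    simp only [map_add, add_mul]
  · intro c x y
    rw [smul_eq_mul, ← integral_const_mul]
    simp only [map_smul, smul_eq_mul, mul_assoc]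
  · intro x y y'
    rw [← integral_add (hint x y) (hint x y')]
    simp only [map_add, mul_add]
  · intro c x y
    rw [smul_eq_mul, ← integral_const_mul]
    simp only [map_smul, smul_eq_mul, mul_left_comm]
  · intro x y
    simp only [LinearMap.mk₂_apply, mul_comm]
  · intro x hx
    rw [LinearMap.mk₂_apply, setIntegral_pos_iff_support_of_nonneg_ae
      (Filter.Eventually.of_forall fun φ => mul_self_nonneg _) (hint x x)]
    have hopen : IsOpen ({φ : A →L[ℝ] ℝ | φ x ≠ 0} ∩ interior (absPolar K)) :=
      (isOpen_ne_fun (by fun_prop) continuous_const).inter isOpen_interior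
    refine (hopen.measure_pos ν ?_).trans_le (measure_mono ?_)
    · obtain ⟨φ, hφ⟩ := SeparatingDual.exists_ne_zero (R := ℝ) hx
      have h0 : Filter.Tendsto (fun t : ℝ => t • φ) (nhdsWithin 0 {0}ᶜ) (nhds 0) := by
        have : Continuous fun t : ℝ => t • φ := by fun_prop
        simpa using (this.tendsto 0).mono_left nhdsWithin_le_nhds
      have h1 := h0.eventually
        (interior_mem_nhds.2 (absPolar_mem_nhds_zero hKb))
      obtain ⟨t, ht, ht0⟩ := (h1.and self_mem_nhdsWithin).exists
      exact ⟨t • φ, by simpa using ⟨ht0, hφ⟩, ht⟩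
    · rintro φ ⟨hφ, hφK⟩
      exact ⟨by simpa using hφ, interior_subset hφK⟩
  · intro T hT x y
    simp only [LinearMap.mk₂_apply]
    let Tc : A ≃L[ℝ] A := T.toContinuousLinearEquiv
    let L : (A →L[ℝ] ℝ) →L[ℝ] (A →L[ℝ] ℝ) :=
      (ContinuousLinearMap.compL ℝ A A ℝ).flip (Tc : A →L[ℝ] A)
    have hLa (φ : A →L[ℝ] ℝ) (z : A) : L φ z = φ (T z) := rfl
    have hinj : Function.Injective L := by
      intro φ ψ h
      ext z
      have := DFunLike.congr_fun h (T.symm z)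
      simpa [hLa] using this
    have himg : L '' absPolar K = absPolar K := by
      ext φ
      constructor
      · rintro ⟨ψ, hψ, rfl⟩ z hz
        exact hψ _ ((hT z).2 hz)
      · intro hφ
        refine ⟨φ ∘L (Tc.symm : A →L[ℝ] A), fun z hz => ?_, ?_⟩
        · exact hφ _ ((hT _).1 (by simpa [Tc] using hz))
        · ext z
          simp [hLa, Tc]
    -- `L` maps the polar, of finite positive volume, onto itself.
    have hdet : |L.det| = 1 := by
      have h := Measure.addHaar_image_continuousLinearMap ν L (absPolar K)
      rw [himg] at h
      have hpos : ν (absPolar K) ≠ 0 :=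
        (Measure.measure_pos_of_mem_nhds ν (absPolar_mem_nhds_zero hKb)).ne'
      have h2 := (ENNReal.eq_div_iff hpos hcomp.measure_lt_top.ne).2 ((mul_comm _ _).trans h.symm)
      rw [ENNReal.div_self hpos hcomp.measure_lt_top.ne] at h2
      exact ENNReal.ofReal_eq_one.1 h2
    have h := integral_image_eq_integral_abs_det_fderiv_smul ν
      (isClosed_absPolar K).measurableSet (fun φ _ => L.hasFDerivWithinAt)
      hinj.injOn (fun φ => φ x * φ y)
    rw [himg] at h
    rw [h]
    simp [hdet, hLa]

end InvariantForm

/-! ### Arithmetic of the cone -/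

namespace AbstractStateSpace

variable {A : Type*} [NormedAddCommGroup A] [NormedSpace ℝ A] (S : AbstractStateSpace A)

theorem zero_mem_cone : (0 : A) ∈ S.cone := by
  obtain ⟨w, hw⟩ := S.nonempty
  exact ⟨0, le_rfl, w, hw, (zero_smul ℝ w).symm⟩

theorem unit_state {w : A} (hw : w ∈ S.states) : S.unit w = 1 :=
  (S.unit_eq_one_iff w (S.states_subset_cone hw)).2 hw

theorem mem_states_of_unit {x : A} (hx : x ∈ S.cone) (h : S.unit x = 1) : x ∈ S.states :=
  (S.unit_eq_one_iff x hx).1 h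

theorem smul_mem_cone {r : ℝ} (hr : 0 ≤ r) {x : A} (hx : x ∈ S.cone) : r • x ∈ S.cone := by
  obtain ⟨s, hs, w, hw, rfl⟩ := hx
  exact ⟨r * s, mul_nonneg hr hs, w, hw, smul_smul r s w⟩

theorem add_mem_cone {x y : A} (hx : x ∈ S.cone) (hy : y ∈ S.cone) : x + y ∈ S.cone := by
  obtain ⟨r, hr, w, hw, rfl⟩ := hx
  obtain ⟨s, hs, v, hv, rfl⟩ := hy
  rcases (add_nonneg hr hs).eq_or_lt with h | h
  · obtain ⟨rfl, rfl⟩ := (add_eq_zero_iff_of_nonneg hr hs).1 h.symm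
    simpa using S.zero_mem_cone
  · refine ⟨r + s, h.le, _, S.convex hw hv (div_nonneg hr h.le) (div_nonneg hs h.le)
      (by field_simp), ?_⟩
    rw [smul_add, smul_smul, smul_smul, mul_div_cancel₀ _ h.ne', mul_div_cancel₀ _ h.ne']

theorem sum_mem_cone {ι : Type*} (s : Finset ι) {f : ι → A} (hf : ∀ i ∈ s, f i ∈ S.cone) :
    ∑ i ∈ s, f i ∈ S.cone :=
  Finset.sum_induction f (· ∈ S.cone) (fun _ _ => S.add_mem_cone) S.zero_mem_cone hf

end AbstractStateSpace

/-! ### Frames, allowed effects and reversible transformations -/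

namespace DynamicalStateSpace

variable {A : Type*} [NormedAddCommGroup A] [NormedSpace ℝ A] {S : DynamicalStateSpace A}

/-- Neither `T` nor `T⁻¹` increases the unit on the cone. -/
theorem unit_map {T : A ≃ₗ[ℝ] A} (hT : T ∈ S.group) (x : A) : S.unit (T x) = S.unit x := by
  refine LinearMap.congr_fun (f := S.unit ∘ₗ (T : A →ₗ[ℝ] A)) (g := S.unit)
    (LinearMap.ext_on S.span_states fun w hw => ?_) x
  have hc := S.states_subset_cone hw
  refine le_antisymm ((S.group_transformation T hT).2 w hc) ?_
  have h := (S.group_transformation T⁻¹ (S.group.inv_mem hT)).2 _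
    ((S.group_transformation T hT).1 w hc)
  have h2 : T⁻¹ (T w) = w := T.symm_apply_apply w
  simpa [h2] using h

theorem map_mem_states {T : A ≃ₗ[ℝ] A} (hT : T ∈ S.group) {w : A} (hw : w ∈ S.states) :
    T w ∈ S.states :=
  S.mem_states_of_unit ((S.group_transformation T hT).1 w (S.states_subset_cone hw))
    ((unit_map hT w).trans (S.unit_state hw))

theorem map_mem_states_iff {T : A ≃ₗ[ℝ] A} (hT : T ∈ S.group) (w : A) :
    T w ∈ S.states ↔ w ∈ S.states := by
  refine ⟨fun h => ?_, map_mem_states hT⟩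
  have h2 : T⁻¹ (T w) = w := T.symm_apply_apply w
  simpa [h2] using map_mem_states (S.group.inv_mem hT) h

theorem map_mem_pureStates {T : A ≃ₗ[ℝ] A} (hT : T ∈ S.group) {w : A} (hw : w ∈ S.pureStates) :
    T w ∈ S.pureStates := by
  have himg : T '' S.states = S.states := by
    ext x
    refine ⟨?_, fun hx => ⟨T.symm x, ?_, T.apply_symm_apply x⟩⟩
    · rintro ⟨y, hy, rfl⟩
      exact map_mem_states hT hy
    · exact (map_mem_states_iff hT _).1 (by simpa using hx)
  have h := image_extremePoints (𝕜 := ℝ) T S.states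
  rw [himg] at h
  exact h.subset (Set.mem_image_of_mem T hw)

theorem zero_mem_allowed : (0 : Module.Dual ℝ A) ∈ S.allowed := by
  have hne : S.allowed.Nonempty := by
    by_contra h
    have h2 := S.allowed_full
    rw [Set.not_nonempty_iff_eq_empty.1 h, Submodule.span_empty] at h2
    obtain ⟨w, hw⟩ := S.nonempty
    have h3 : S.unit = 0 := (Submodule.mem_bot ℝ).1 (h2.symm ▸ Submodule.mem_top)
    simpa [h3] using S.unit_state hw
  obtain ⟨e, he⟩ := hne
  have hu : S.unit ∈ S.allowed := by
    simpa using S.allowed_add e he _ (S.allowed_compl e he) fun x _ => by simp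
  simpa using S.allowed_compl _ hu

theorem unit_mem_allowed : S.unit ∈ S.allowed := by
  simpa using S.allowed_compl _ (zero_mem_allowed (S := S))

theorem isFrame_single {w : A} (hw : w ∈ S.pureStates) : S.IsFrame fun _ : Fin 1 => w := by
  refine ⟨fun _ => hw, fun _ => hw.1, fun _ => S.unit, fun _ => unit_mem_allowed, ?_, ?_⟩
  · intro x _
    simp
  · intro j k
    simpa [Subsingleton.elim j k] using S.unit_state hw.1

theorem IsFrame.comp {n k : ℕ} {w : Fin n → A} (hw : S.IsFrame w) {σ : Fin k → Fin n}
    (hσ : Function.Injective σ) : S.IsFrame (w ∘ σ) := by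
  obtain ⟨hp, hs, e, he, hsum, hδ⟩ := hw
  refine ⟨fun j => hp _, fun j => hs _, e ∘ σ, fun j => he _, fun x hx => ?_, fun j k => ?_⟩
  · refine le_trans ?_ (hsum x hx)
    have h := Finset.sum_le_sum_of_subset_of_nonneg
      (Finset.subset_univ (Finset.univ.map ⟨σ, hσ⟩)) (f := fun j => e j x)
      fun j _ _ => (S.allowed_subset (he j) x hx).1
    simpa using h
  · simp [hδ, hσ.eq_iff]

theorem IsFrame.map {n : ℕ} {w : Fin n → A} (hw : S.IsFrame w) {T : A ≃ₗ[ℝ] A}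
    (hT : T ∈ S.group) : S.IsFrame fun j => T (w j) := by
  obtain ⟨hp, hs, e, he, hsum, hδ⟩ := hw
  refine ⟨fun j => map_mem_pureStates hT (hp j), fun j => map_mem_states hT (hs j),
    fun j => e j ∘ₗ ((T⁻¹ : A ≃ₗ[ℝ] A) : A →ₗ[ℝ] A),
    fun j => S.allowed_comp _ (he j) _ (S.group.inv_mem hT), fun x hx => ?_, fun j k => ?_⟩
  · have hTi := S.group.inv_mem hT
    have h := hsum _ ((S.group_transformation _ hTi).1 x hx)
    exact h.trans_eq (unit_map hTi x)
  · simp [hδ]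

theorem IsFrame.pair {n : ℕ} {w : Fin n → A} (hw : S.IsFrame w) {j k : Fin n} (h : j ≠ k) :
    S.IsFrame ![w j, w k] := by
  have := hw.comp (σ := ![j, k]) (by
    intro a b hab
    fin_cases a <;> fin_cases b <;> simp_all)
  convert this using 1
  ext i
  fin_cases i <;> rfl

theorem isFrame_pair_of_effect {w v : A} (hw : w ∈ S.pureStates) (hv : v ∈ S.pureStates)
    {e : Module.Dual ℝ A} (he : e ∈ S.allowed) (hew : e w = 1) (hev : e v = 0) :
    S.IsFrame ![w, v] := by
  refine ⟨?_, ?_, ![e, S.unit - e], ?_, ?_, ?_⟩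
  · intro j; fin_cases j <;> assumption
  · intro j; fin_cases j
    exacts [hw.1, hv.1]
  · intro j; fin_cases j
    exacts [he, S.allowed_compl e he]
  · intro x _
    simp [Fin.sum_univ_two]
  · intro j k
    fin_cases j <;> fin_cases k <;> simp [hew, hev, S.unit_state hw.1, S.unit_state hv.1]

theorem ClassicalDecomposability.dual_ext (h1 : S.ClassicalDecomposability)
    {f g : Module.Dual ℝ A} (h : ∀ w ∈ S.pureStates, f w = g w) : f = g := by
  refine LinearMap.ext_on S.span_states fun w hw => ?_
  obtain ⟨n, p, v, -, -, hv, rfl⟩ := h1 w hw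
  simp [h _ (hv.1 _)]

/-! ### The invariant state and maximal frames -/

section Invariant

variable [FiniteDimensional ℝ A]

/-- The data of an inner product on `A` invariant under the reversible transformations. -/
structure IsInvariantInner (S : DynamicalStateSpace A) (b : LinearMap.BilinForm ℝ A) : Prop where
  symm : ∀ x y, b x y = b y x
  posDef : ∀ x, x ≠ 0 → 0 < b x x
  invariant : ∀ T ∈ S.group, ∀ x y, b (T x) (T y) = b x y

theorem exists_isInvariantInner (S : DynamicalStateSpace A) :
    ∃ b : LinearMap.BilinForm ℝ A, S.IsInvariantInner b := by
  obtain ⟨b, hs, hp, hi⟩ := exists_invariant_bilinForm S.compact.isBounded S.span_states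
  exact ⟨b, hs, hp, fun T hT => hi T (map_mem_states_iff hT)⟩

/-- The shortest state is unique by strict convexity: if `T μ ≠ μ`, their midpoint would be a
shorter state. -/
theorem exists_fixed_state {b : LinearMap.BilinForm ℝ A} (hb : S.IsInvariantInner b) :
    ∃ μ ∈ S.states, ∀ T ∈ S.group, T μ = μ := by
  have hcont : Continuous fun x : A => b x x := by
    have h : Continuous fun x : A => b.toContinuousBilinearMap x x := by fun_prop
    exact h
  obtain ⟨μ, hμ, hmin⟩ := S.compact.exists_isMinOn S.nonempty hcont.continuousOn
  refine ⟨μ, hμ, fun T hT => ?_⟩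
  by_contra hne
  have hpos := hb.posDef _ (sub_ne_zero.2 hne)
  have hmid : b μ μ ≤ b ((1 / 2 : ℝ) • T μ + (1 / 2 : ℝ) • μ) ((1 / 2 : ℝ) • T μ + (1 / 2 : ℝ) • μ) :=
    hmin (S.convex (map_mem_states hT hμ) hμ (by norm_num) (by norm_num) (by norm_num))
  have hinv := hb.invariant T hT μ μ
  have hsymm := hb.symm (T μ) μ
  simp only [map_sub, map_add, map_smul, LinearMap.sub_apply, LinearMap.add_apply,
    LinearMap.smul_apply, smul_eq_mul] at hpos hmid
  linarith

end Invariant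

/-- `N` is the size of the maximal frames and every maximal frame sums to `M`. -/
structure IsFrameSum (S : DynamicalStateSpace A) (N : ℕ) (M : A) : Prop where
  sum_eq : ∀ V : Fin N → A, S.IsFrame V → ∑ j, V j = M
  extend : ∀ (k : ℕ) (v : Fin k → A), S.IsFrame v →
    ∃ (l : ℕ) (V : Fin (k + l) → A), k + l = N ∧ S.IsFrame V ∧ ∀ j, V (Fin.castAdd l j) = v j

theorem exists_isFrameSum (h1 : S.ClassicalDecomposability) (h2 : S.StrongSymmetry)
    {μ : A} (hμ : μ ∈ S.states) (hfix : ∀ T ∈ S.group, T μ = μ) :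
    ∃ N : ℕ, 0 < N ∧ S.IsFrameSum N ((N : ℝ) • μ) := by
  obtain ⟨n, p, w, hp, hsum, hw, rfl⟩ := h1 μ hμ
  have hn : 0 < n := by
    rcases Nat.eq_zero_or_pos n with rfl | h
    · simp at hsum
    · exact h
  -- Some group element realizes the transposition of `i` and `j` on the frame while fixing `μ`; the
  -- effect `e i` compares the two weights.
  have hconst (i j : Fin n) : p i = p j := by
    obtain ⟨T, hT, hTw⟩ := h2 n w (w ∘ Equiv.swap i j) hw (hw.comp (Equiv.injective _))
    have h := hfix T hT
    obtain ⟨-, -, e, -, -, hδ⟩ := hw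
    have h3 := congrArg (e i) h
    simp only [map_sum, map_smul, hTw, Function.comp_apply, hδ, smul_eq_mul] at h3
    have h4 (x : Fin n) : i = Equiv.swap i j x ↔ j = x := by
      rw [eq_comm, ← Equiv.eq_symm_apply]; simp [eq_comm]
    simpa [h4, eq_comm] using h3
  have hpn (j : Fin n) : (n : ℝ) * p j = 1 := by
    rw [← hsum, Finset.sum_congr rfl fun i _ => hconst i j]
    simp
  have hM : (n : ℝ) • ∑ j, p j • w j = ∑ j, w j := by
    simp [Finset.smul_sum, smul_smul, hpn]
  set M := (n : ℝ) • ∑ j, p j • w j with hMdef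
  have hMfix : ∀ T ∈ S.group, T M = M := fun T hT => by rw [hMdef, map_smul, hfix T hT]
  have hext (k : ℕ) (hk : k ≤ n) (v : Fin k → A) (hv : S.IsFrame v) :
      ∃ V : Fin n → A, S.IsFrame V ∧ ∑ j, V j = M ∧ ∀ j, V (Fin.castLE hk j) = v j := by
    obtain ⟨T, hT, hTw⟩ := h2 k (w ∘ Fin.castLE hk) v (hw.comp (Fin.castLE_injective hk)) hv
    exact ⟨fun j => T (w j), hw.map hT, by rw [← map_sum, ← hM, hMfix T hT], hTw⟩
  have hsumM (V : Fin n → A) (hV : S.IsFrame V) : ∑ j, V j = M := by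
    obtain ⟨V', -, hs, he⟩ := hext n le_rfl V hV
    rw [← hs]
    exact Finset.sum_congr rfl fun j _ => (he j).symm
  refine ⟨n, hn, hsumM, fun k v hv => ?_⟩
  -- In a longer frame, the effect of the member at index `n` vanishes on the first `n` members,
  -- hence on their sum `M`. But that member also lies in an `n`-frame with sum `M`, which forces
  -- the effect to vanish on it too.
  have hk : k ≤ n := by
    by_contra hlt
    rw [not_le] at hlt
    have hs := hsumM _ (hv.comp (Fin.castLE_injective hlt.le))
    obtain ⟨V', hV', hs', he'⟩ := hext 1 hn _ (isFrame_single (hv.1 ⟨n, hlt⟩))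
    obtain ⟨-, -, e, he, -, hδ⟩ := hv
    have h0 : e ⟨n, hlt⟩ M = 0 := by
      rw [← hs, map_sum]
      refine Finset.sum_eq_zero fun j _ => ?_
      rw [Function.comp_apply, hδ, if_neg]
      intro h
      have := congrArg Fin.val h
      simp at this
      omega
    rw [← hs', map_sum] at h0
    have h3 := (Finset.sum_eq_zero_iff_of_nonneg fun j _ =>
      (S.allowed_subset (he _) _ (S.states_subset_cone (hV'.1 j).1)).1).1 h0
      (Fin.castLE hn 0) (Finset.mem_univ _)
    rw [he' 0, hδ] at h3
    simp at h3
  obtain ⟨l, rfl⟩ := Nat.exists_eq_add_of_le hk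
  obtain ⟨V, hV, -, he⟩ := hext k hk v hv
  exact ⟨l, V, rfl, hV, he⟩

/-! ### Decompositions along maximal frames -/

section FrameSum

variable {N : ℕ} {M : A}

theorem IsFrameSum.extend_single (hN : S.IsFrameSum N M) {w : A} (hw : w ∈ S.pureStates) :
    ∃ (V : Fin N → A) (i : Fin N), S.IsFrame V ∧ V i = w := by
  obtain ⟨l, V, rfl, hV, he⟩ := hN.extend 1 _ (isFrame_single hw)
  exact ⟨V, Fin.castAdd l 0, hV, he 0⟩

/-- Padding with zero weights leaves entropy sums unchanged, so frames of different lengths can be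
compared. -/
theorem IsClassicalDecomposition.extend (hN : S.IsFrameSum N M) {w : A} {n : ℕ} {p : Fin n → ℝ}
    {v : Fin n → A} (h : S.IsClassicalDecomposition w p v) :
    ∃ (q : Fin N → ℝ) (V : Fin N → A), S.IsClassicalDecomposition w q V ∧
      ∀ f : ℝ → ℝ, f 0 = 0 → ∑ j, f (q j) = ∑ j, f (p j) := by
  obtain ⟨hp, hsum, hv, rfl⟩ := h
  obtain ⟨l, V, rfl, hV, he⟩ := hN.extend n v hv
  refine ⟨Fin.append p 0, V, ⟨?_, ?_, hV, ?_⟩, ?_⟩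
  · intro j
    refine Fin.addCases (fun i => ?_) (fun i => ?_) j <;> simp [hp]
  · simp [Fin.sum_univ_add, hsum]
  · simp [Fin.sum_univ_add, he]
  · intro f hf
    simp [Fin.sum_univ_add, hf]

theorem IsFrameSum.exists_decomposition (hN : S.IsFrameSum N M) (h1 : S.ClassicalDecomposability)
    {w : A} (hw : w ∈ S.states) :
    ∃ (q : Fin N → ℝ) (V : Fin N → A), S.IsClassicalDecomposition w q V := by
  obtain ⟨n, p, v, h⟩ := h1 w hw
  obtain ⟨q, V, hq, -⟩ := h.extend hN
  exact ⟨q, V, hq⟩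

theorem IsClassicalDecomposition.le_one {w : A} {n : ℕ} {p : Fin n → ℝ}
    {v : Fin n → A} (h : S.IsClassicalDecomposition w p v) (j : Fin n) : p j ≤ 1 :=
  h.2.1 ▸ Finset.single_le_sum (fun i _ => h.1 i) (Finset.mem_univ j)

theorem IsFrameSum.sub_mem_cone (hN : S.IsFrameSum N M) (h1 : S.ClassicalDecomposability)
    {w : A} (hw : w ∈ S.states) : M - w ∈ S.cone := by
  obtain ⟨q, V, h⟩ := hN.exists_decomposition h1 hw
  rw [← hN.sum_eq V h.2.2.1, h.2.2.2, ← Finset.sum_sub_distrib]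
  refine S.sum_mem_cone _ fun j _ => ?_
  have hs : V j - q j • V j = (1 - q j) • V j := by module
  rw [hs]
  exact S.smul_mem_cone (sub_nonneg.2 (h.le_one j))
    (S.states_subset_cone (h.2.2.1.1 j).1)

/-- Every vector is a real linear combination of a maximal frame. -/
theorem IsFrameSum.exists_spectral (hN : S.IsFrameSum N M) (h1 : S.ClassicalDecomposability)
    (y : A) : ∃ (c : Fin N → ℝ) (V : Fin N → A), S.IsFrame V ∧ y = ∑ j, c j • V j := by
  -- `M` is an order unit, and it is the sum of every maximal frame, so shifting `y` by `s • M` only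
  -- shifts its coefficients. Both signs are carried so that the induction survives negative
  -- scalars.
  have key : ∃ s : ℝ, s • M + y ∈ S.cone ∧ s • M - y ∈ S.cone := by
    have hy : y ∈ Submodule.span ℝ S.states := S.span_states ▸ Submodule.mem_top
    induction hy using Submodule.span_induction with
    | mem w hw =>
      have hc := S.states_subset_cone hw
      have hs := hN.sub_mem_cone h1 hw
      refine ⟨1, ?_, by simpa using hs⟩
      have : (1 : ℝ) • M + w = (M - w) + (w + w) := by module
      rw [this]
      exact S.add_mem_cone hs (S.add_mem_cone hc hc)
    | zero => exact ⟨0, by simpa using S.zero_mem_cone, by simpa using S.zero_mem_cone⟩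
    | add x y _ _ hx hy =>
      obtain ⟨s, hs, hs'⟩ := hx
      obtain ⟨t, ht, ht'⟩ := hy
      refine ⟨s + t, ?_, ?_⟩
      · convert S.add_mem_cone hs ht using 1
        module
      · convert S.add_mem_cone hs' ht' using 1
        module
    | smul a x _ hx =>
      obtain ⟨s, hs, hs'⟩ := hx
      rcases le_total 0 a with ha | ha
      · refine ⟨a * s, ?_, ?_⟩
        · convert S.smul_mem_cone ha hs using 1
          module
        · convert S.smul_mem_cone ha hs' using 1
          module
      · refine ⟨-a * s, ?_, ?_⟩
        · convert S.smul_mem_cone (neg_nonneg.2 ha) hs' using 1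
          module
        · convert S.smul_mem_cone (neg_nonneg.2 ha) hs using 1
          module
  obtain ⟨s, ⟨r, -, w, hw, h⟩, -⟩ := key
  obtain ⟨q, V, hq⟩ := hN.exists_decomposition h1 hw
  refine ⟨fun j => r * q j - s, V, hq.2.2.1, ?_⟩
  have hM := hN.sum_eq V hq.2.2.1
  simp only [sub_smul, Finset.sum_sub_distrib, mul_smul, ← Finset.smul_sum]
  rw [hM, ← hq.2.2.2, ← h]
  module

end FrameSum

/-- `B` is an inner product for which the frames are orthonormal. -/
structure IsFrameInner (S : DynamicalStateSpace A) (B : LinearMap.BilinForm ℝ A) : Prop where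
  symm : ∀ x y, B x y = B y x
  posDef : ∀ x, x ≠ 0 → 0 < B x x
  frame : ∀ (n : ℕ) (w : Fin n → A), S.IsFrame w → ∀ j k, B (w j) (w k) = if j = k then 1 else 0

theorem IsSelfDualizing.isFrameInner {B : LinearMap.BilinForm ℝ A} (hB : S.IsSelfDualizing B) :
    S.IsFrameInner B := by
  refine ⟨hB.symm, hB.posDef, fun n w hw j k => ?_⟩
  split_ifs with h
  · subst h
    exact hB.pure_eq_one _ (hw.1 j)
  · exact hB.distinguishable_orthogonal _ _ (hw.pair h).2

/-- By strong symmetry `b` has one value on all pure states and one value `g` on all pairs from a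
frame. Subtracting `g • u ⊗ u` makes frames orthogonal; the result stays positive definite because
`g < b μ μ`. -/
theorem IsInvariantInner.exists_isFrameInner {b : LinearMap.BilinForm ℝ A}
    (hb : S.IsInvariantInner b) (h1 : S.ClassicalDecomposability) (h2 : S.StrongSymmetry) {N : ℕ} {μ : A} (hμ : μ ∈ S.states)
    (hfix : ∀ T ∈ S.group, T μ = μ) (hpos : 0 < N) (hN : S.IsFrameSum N ((N : ℝ) • μ)) :
    ∃ B : LinearMap.BilinForm ℝ A, S.IsFrameInner B ∧
      ∀ T ∈ S.group, ∀ x y, B (T x) (T y) = B x y := by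
  obtain ⟨_, V, hV⟩ := hN.exists_decomposition h1 hμ
  replace hV := hV.2.2.1
  set w₀ := V ⟨0, hpos⟩ with hw₀
  have hw₀p : w₀ ∈ S.pureStates := hV.1 _
  have htrans {w v : A} (hw : w ∈ S.pureStates) (hv : v ∈ S.pureStates) :
      ∃ T ∈ S.group, T w = v := by
    obtain ⟨T, hT, h⟩ := h2 1 _ _ (isFrame_single hw) (isFrame_single hv)
    exact ⟨T, hT, h 0⟩
  have hpure {w : A} (hw : w ∈ S.pureStates) : b w w = b w₀ w₀ := by
    obtain ⟨T, hT, rfl⟩ := htrans hw₀p hw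
    exact hb.invariant T hT _ _
  have hμu (x : A) : b μ x = b μ μ * S.unit x := by
    have h : b μ = b μ w₀ • S.unit := h1.dual_ext fun w hw => by
      obtain ⟨T, hT, rfl⟩ := htrans hw₀p hw
      have := hb.invariant T hT μ w₀
      rw [hfix T hT] at this
      simp [this, S.unit_state (map_mem_states hT hw₀p.1)]
    have hμμ := LinearMap.congr_fun h μ
    simp only [LinearMap.smul_apply, S.unit_state hμ, smul_eq_mul, mul_one] at hμμ
    rw [hμμ, h]
    simp [S.unit_state hw₀p.1]
  -- The component of `x` along `μ` is `S.unit x • μ`, by `hμu`.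
  have hlow (x : A) : b μ μ * S.unit x ^ 2 ≤ b x x := by
    have h : 0 ≤ b (x - S.unit x • μ) (x - S.unit x • μ) := by
      by_cases h0 : x - S.unit x • μ = 0
      · simp [h0]
      · exact (hb.posDef _ h0).le
    simp only [map_sub, map_smul, LinearMap.sub_apply, LinearMap.smul_apply, smul_eq_mul,
      hb.symm x μ, hμu x] at h
    nlinarith
  obtain ⟨g, hgμ, hg⟩ : ∃ g < b μ μ, ∀ w v, S.IsFrame ![w, v] → b w v = g := by
    by_cases hex : ∃ w v, S.IsFrame ![w, v]
    · obtain ⟨w, v, hwv⟩ := hex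
      have hg (x y : A) (hxy : S.IsFrame ![x, y]) : b x y = b w v := by
        obtain ⟨T, hT, h⟩ := h2 2 _ _ hwv hxy
        have e0 : T w = x := by simpa using h 0
        have e1 : T v = y := by simpa using h 1
        rw [← e0, ← e1, hb.invariant T hT]
      refine ⟨b w v, ?_, hg⟩
      have hne : w - v ≠ 0 := by
        rw [sub_ne_zero]
        rintro rfl
        obtain ⟨e, -, -, hδ⟩ := hwv.2.2
        have e0 := hδ 0 0
        have e1 := hδ 0 1
        simp at e0 e1
        linarith
      have hlt := hb.posDef _ hne
      have hsymm := hb.symm w v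
      have hww := hpure (hwv.1 0)
      have hvv := hpure (hwv.1 1)
      simp only [Matrix.cons_val_zero, Matrix.cons_val_one] at hww hvv
      simp only [map_sub, LinearMap.sub_apply] at hlt
      have hsum : ∑ j, b (V j) w₀ = N * b μ μ := by
        rw [← LinearMap.sum_apply, ← map_sum, hN.sum_eq V hV, map_smul, LinearMap.smul_apply,
          hμu, S.unit_state hw₀p.1, mul_one, smul_eq_mul]
      -- The off-diagonal terms equal `g` and the diagonal one exceeds it, so their mean `b μ μ`
      -- exceeds `g`.
      have hgt : ∑ _j : Fin N, b w v < ∑ j, b (V j) w₀ := by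
        have h0 : b w v < b w₀ w₀ := by linarith
        refine Finset.sum_lt_sum (fun j _ => ?_) ⟨⟨0, hpos⟩, Finset.mem_univ _, h0⟩
        by_cases hj : j = ⟨0, hpos⟩
        · rw [hj]
          exact h0.le
        · exact (hg _ _ (hV.pair hj)).ge
      rw [hsum] at hgt
      simp only [Finset.sum_const, Finset.card_univ, Fintype.card_fin, nsmul_eq_mul] at hgt
      exact lt_of_mul_lt_mul_left hgt (Nat.cast_nonneg N)
    -- Without distinguishable pairs, any value below `b μ μ` serves.
    · exact ⟨b μ μ - 1, by linarith, fun w v h => absurd ⟨w, v, h⟩ hex⟩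
  have ha : 0 < b w₀ w₀ - g := by
    have := hlow w₀
    rw [S.unit_state hw₀p.1] at this
    linarith
  have happ (x y : A) : ((b w₀ w₀ - g)⁻¹ • (b - g • S.unit.smulRight S.unit)) x y =
      (b w₀ w₀ - g)⁻¹ * (b x y - g * (S.unit x * S.unit y)) := by
    simp
  refine ⟨(b w₀ w₀ - g)⁻¹ • (b - g • S.unit.smulRight S.unit), ⟨?_, ?_, ?_⟩, ?_⟩
  · intro x y
    rw [happ, happ, hb.symm x y, mul_comm (S.unit x)]
  · intro x hx
    rw [happ]
    refine mul_pos (inv_pos.2 ha) ?_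
    by_cases hu : S.unit x = 0
    · simpa [hu] using hb.posDef x hx
    · have := mul_pos (sub_pos.2 hgμ) (sq_pos_of_ne_zero hu)
      have := hlow x
      nlinarith
  · intro n w hw j k
    rw [happ, S.unit_state (hw.1 j).1, S.unit_state (hw.1 k).1]
    split_ifs with hjk
    · subst hjk
      rw [hpure (hw.1 j), mul_one, mul_one, inv_mul_cancel₀ ha.ne']
    · rw [hg _ _ (hw.pair hjk)]
      simp
  · intro T hT x y
    rw [happ, happ, hb.invariant T hT, unit_map hT, unit_map hT]

/-! ### Self-duality and entropy -/

section FrameInner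

variable {B : LinearMap.BilinForm ℝ A} {N : ℕ} {M : A}

theorem IsFrameInner.eq_of_sub_nonpos (hB : S.IsFrameInner B) {x y : A}
    (h : B (x - y) (x - y) ≤ 0) : x = y := by
  by_contra hne
  exact absurd (hB.posDef _ (sub_ne_zero.2 hne)) (not_lt.2 h)

theorem IsFrameInner.apply_frame_sum (hB : S.IsFrameInner B) {n : ℕ} {v : Fin n → A}
    (hv : S.IsFrame v) (c : Fin n → ℝ) (j : Fin n) : B (∑ k, c k • v k) (v j) = c j := by
  simp [hB.frame n v hv]

theorem IsFrameInner.self_frame_sum (hB : S.IsFrameInner B) {n : ℕ} {v : Fin n → A}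
    (hv : S.IsFrame v) (c : Fin n → ℝ) :
    B (∑ k, c k • v k) (∑ k, c k • v k) = ∑ k, c k ^ 2 := by
  rw [map_sum]
  refine Finset.sum_congr rfl fun j _ => ?_
  rw [map_smul, hB.apply_frame_sum hv, smul_eq_mul, sq]

theorem IsFrameInner.apply_unit (hB : S.IsFrameInner B) (hN : S.IsFrameSum N M)
    (h1 : S.ClassicalDecomposability) (x : A) : B M x = S.unit x := by
  have hpure : ∀ w ∈ S.pureStates, B M w = 1 := by
    intro w hw
    obtain ⟨V, i, hV, rfl⟩ := hN.extend_single hw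
    rw [← hN.sum_eq V hV]
    simp [hB.frame N V hV]
  exact LinearMap.congr_fun (h1.dual_ext fun w hw => (hpure w hw).trans
    (S.unit_state hw.1).symm) x

theorem IsFrameInner.exists_repr [FiniteDimensional ℝ A] (hB : S.IsFrameInner B)
    (f : Module.Dual ℝ A) : ∃ a, f = B a := by
  have hinj : Function.Injective B := by
    intro x y h
    exact hB.eq_of_sub_nonpos (by simp [h])
  obtain ⟨a, ha⟩ := (LinearMap.injective_iff_surjective_of_finrank_eq_finrank
    Subspace.dual_finrank_eq.symm).1 hinj f
  exact ⟨a, ha.symm⟩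

/-- The functional represented by a pure state is an allowed effect. -/
theorem IsFrameInner.mem_allowed [FiniteDimensional ℝ A] (hB : S.IsFrameInner B)
    (hN : S.IsFrameSum N M) (h1 : S.ClassicalDecomposability) {w : A} (hw : w ∈ S.pureStates) :
    B w ∈ S.allowed := by
  obtain ⟨V, i, hV, rfl⟩ := hN.extend_single hw
  obtain ⟨e, he, -, hδ⟩ := hV.2.2
  -- The vector `a` representing the effect that singles out `V i` turns out to be `V i`. Its
  -- coefficients lie in `[0, 1]` and sum to `e i M = 1`, so `B a a ≤ 1`; with `B a (V i) = 1` this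
  -- leaves no room for `a - V i`.
  obtain ⟨a, ha⟩ := hB.exists_repr (e i)
  obtain ⟨c, X, hX, haX⟩ := hN.exists_spectral h1 a
  have hc (j : Fin N) : c j = e i (X j) := by
    rw [ha, haX, hB.apply_frame_sum hX]
  have hcsum : ∑ j, c j = 1 := by
    simp_rw [hc]
    rw [← map_sum, hN.sum_eq X hX, ← hN.sum_eq V hV, map_sum]
    simp [hδ]
  have haa : B a a ≤ 1 := by
    rw [haX, hB.self_frame_sum hX, ← hcsum]
    refine Finset.sum_le_sum fun j _ => ?_
    have hb := S.allowed_subset (he i) (X j) (S.states_subset_cone (hX.1 j).1)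
    rw [S.unit_state (hX.1 j).1, ← hc] at hb
    nlinarith [hb.1, hb.2]
  have haV : B a (V i) = 1 := by simpa [hδ] using (LinearMap.congr_fun ha (V i)).symm
  have hVV : B (V i) (V i) = 1 := by simpa using hB.frame N V hV i i
  have : a = V i := hB.eq_of_sub_nonpos (by
    have hs := hB.symm a (V i)
    simp only [map_sub, LinearMap.sub_apply]
    linarith)
  rw [← this, ← ha]
  exact he i

theorem IsFrameInner.self_le_one (hB : S.IsFrameInner B) (h1 : S.ClassicalDecomposability)
    {w : A} (hw : w ∈ S.states) : B w w ≤ 1 := by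
  obtain ⟨n, p, v, h⟩ := h1 w hw
  rw [h.2.2.2, hB.self_frame_sum h.2.2.1, ← h.2.1]
  refine Finset.sum_le_sum fun j _ => ?_
  nlinarith [h.1 j, h.le_one j]

/-- The squared norm is `∑ p j ^ 2`, which reaches `∑ p j = 1` only if every weight is 0 or 1. -/
theorem IsFrameInner.mem_pureStates (hB : S.IsFrameInner B) (h1 : S.ClassicalDecomposability)
    {w : A} (hw : w ∈ S.states) (hww : 1 ≤ B w w) : w ∈ S.pureStates := by
  obtain ⟨n, p, v, h⟩ := h1 w hw
  have hsq : ∑ j, p j * (1 - p j) ≤ 0 := by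
    have := hB.self_frame_sum h.2.2.1 p
    rw [← h.2.2.2] at this
    simp only [mul_sub, mul_one, Finset.sum_sub_distrib, h.2.1, ← sq]
    linarith
  have hz := (Finset.sum_eq_zero_iff_of_nonneg fun j _ =>
    mul_nonneg (h.1 j) (sub_nonneg.2 (h.le_one j))).1
    (hsq.antisymm (Finset.sum_nonneg fun j _ =>
      mul_nonneg (h.1 j) (sub_nonneg.2 (h.le_one j))))
  obtain ⟨j, hj⟩ : ∃ j, p j ≠ 0 := by
    by_contra! h0
    have := h.2.1
    simp [h0] at this
  have hpj : p j = 1 := by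
    have := (mul_eq_zero.1 (hz j (Finset.mem_univ j))).resolve_left hj
    linarith
  have hwj : w = v j := hB.eq_of_sub_nonpos (by
    have e1 : B w (v j) = 1 := by rw [h.2.2.2, hB.apply_frame_sum h.2.2.1, hpj]
    have e2 := hB.symm w (v j)
    have e3 : B (v j) (v j) = 1 := by simpa using hB.frame n v h.2.2.1 j j
    have e4 := hB.self_le_one h1 hw
    simp only [map_sub, LinearMap.sub_apply]
    linarith)
  exact hwj ▸ h.2.2.1.1 j

theorem IsFrameInner.nonneg [FiniteDimensional ℝ A] (hB : S.IsFrameInner B)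
    (hN : S.IsFrameSum N M) (h1 : S.ClassicalDecomposability) {x y : A} (hx : x ∈ S.cone)
    (hy : y ∈ S.cone) : 0 ≤ B x y := by
  obtain ⟨r, hr, w, hw, rfl⟩ := hx
  obtain ⟨n, p, v, hp, -, hv, rfl⟩ := h1 w hw
  simp only [map_smul, map_sum, LinearMap.smul_apply, LinearMap.sum_apply, smul_eq_mul]
  exact mul_nonneg hr (Finset.sum_nonneg fun j _ => mul_nonneg (hp j)
    (S.allowed_subset (hB.mem_allowed hN h1 (hv.1 j)) y hy).1)

theorem IsClassicalDecomposition.effect_eq_one {w : A} {n : ℕ} {p : Fin n → ℝ}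
    {v : Fin n → A} (h : S.IsClassicalDecomposition w p v) {e : Module.Dual ℝ A}
    (he : e ∈ S.effects) (hew : e w = 1) {j : Fin n} (hj : p j ≠ 0) : e (v j) = 1 := by
  have hle (i : Fin n) : 0 ≤ 1 - e (v i) := by
    have := (he (v i) (S.states_subset_cone (h.2.2.1.1 i).1)).2
    rw [S.unit_state (h.2.2.1.1 i).1] at this
    linarith
  have hs : ∑ i, p i * (1 - e (v i)) = 0 := by
    rw [h.2.2.2] at hew
    simp only [map_sum, map_smul, smul_eq_mul] at hew
    simp only [mul_sub, mul_one, Finset.sum_sub_distrib, h.2.1, hew, sub_self]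
  have := (Finset.sum_eq_zero_iff_of_nonneg fun i _ => mul_nonneg (h.1 i) (hle i)).1 hs j
    (Finset.mem_univ j)
  linarith [(mul_eq_zero.1 this).resolve_left hj]

theorem IsClassicalDecomposition.effect_eq_zero {w : A} {n : ℕ} {p : Fin n → ℝ}
    {v : Fin n → A} (h : S.IsClassicalDecomposition w p v) {e : Module.Dual ℝ A}
    (he : e ∈ S.effects) (hew : e w = 0) {j : Fin n} (hj : p j ≠ 0) : e (v j) = 0 := by
  have hle (i : Fin n) : 0 ≤ e (v i) := (he (v i) (S.states_subset_cone (h.2.2.1.1 i).1)).1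
  rw [h.2.2.2] at hew
  simp only [map_sum, map_smul, smul_eq_mul] at hew
  have := (Finset.sum_eq_zero_iff_of_nonneg fun i _ => mul_nonneg (h.1 i) (hle i)).1 hew j
    (Finset.mem_univ j)
  exact (mul_eq_zero.1 this).resolve_left hj

/-- An effect separating `w` from `v` is 1 on each pure component of `w` and 0 on each of `v`, so it
already makes every such pair a frame. -/
theorem IsFrameInner.orthogonal (hB : S.IsFrameInner B) (h1 : S.ClassicalDecomposability)
    {w v : A} (h : S.PerfectlyDistinguishable ![w, v]) : B w v = 0 := by
  obtain ⟨hs, e, he, -, hδ⟩ := h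
  obtain ⟨n, p, x, hx⟩ := h1 w (hs 0)
  obtain ⟨m, q, y, hy⟩ := h1 v (hs 1)
  have hew : e 0 w = 1 := by simpa using hδ 0 0
  have hev : e 0 v = 0 := by simpa using hδ 0 1
  rw [hx.2.2.2, hy.2.2.2]
  simp only [map_smul, map_sum, LinearMap.smul_apply, LinearMap.sum_apply, smul_eq_mul]
  refine Finset.sum_eq_zero fun k _ => ?_
  rw [mul_eq_zero, or_iff_not_imp_left]
  intro hk
  refine Finset.sum_eq_zero fun j _ => ?_
  rw [mul_eq_zero, or_iff_not_imp_left]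
  intro hj
  have heff := S.allowed_subset (he 0)
  have hf := isFrame_pair_of_effect (hx.2.2.1.1 j) (hy.2.2.1.1 k) (he 0)
    (hx.effect_eq_one heff hew hj) (hy.effect_eq_zero heff hev hk)
  simpa using hB.frame 2 _ hf 0 1

theorem IsFrameInner.isSelfDualizing [FiniteDimensional ℝ A] (hB : S.IsFrameInner B)
    (hinv : ∀ T ∈ S.group, ∀ x y, B (T x) (T y) = B x y)
    (hN : S.IsFrameSum N M) (h1 : S.ClassicalDecomposability) : S.IsSelfDualizing B where
  symm := hB.symm
  posDef := hB.posDef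
  selfDual := by
    ext f
    constructor
    · intro hf
      obtain ⟨a, rfl⟩ := hB.exists_repr f
      obtain ⟨c, V, hV, rfl⟩ := hN.exists_spectral h1 a
      refine ⟨_, S.sum_mem_cone _ fun j _ => ?_, rfl⟩
      have hVj := S.states_subset_cone (hV.1 j).1
      have h := hf (V j) hVj
      -- The spectral coefficients of `a` are the values of the functional on `V`, hence
      -- nonnegative.
      rw [hB.apply_frame_sum hV] at h
      exact S.smul_mem_cone h hVj
    · rintro ⟨w, hw, rfl⟩ x hx
      exact hB.nonneg hN h1 hw hx
  invariant := hinv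
  mem_unitInterval := by
    intro w hw v hv
    refine ⟨hB.nonneg hN h1 (S.states_subset_cone hw) (S.states_subset_cone hv), ?_⟩
    by_contra hlt
    have e1 := hB.self_le_one h1 hw
    have e2 := hB.self_le_one h1 hv
    have e3 := hB.symm w v
    have : w = v := hB.eq_of_sub_nonpos (by
      simp only [map_sub, LinearMap.sub_apply]
      linarith)
    subst this
    exact hlt e1
  pure_eq_one := fun w hw => by simpa using hB.frame 1 _ (isFrame_single hw) 0 0
  mixed_lt_one := fun w hw hn => by
    by_contra h
    exact hn (hB.mem_pureStates h1 hw (not_lt.1 h))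
  distinguishable_orthogonal := fun w v h => hB.orthogonal h1 h

/-- A positive, normalization-preserving, symmetric map does not decrease the entropy. -/
theorem IsFrameInner.sum_negMulLog_le [FiniteDimensional ℝ A] (hB : S.IsFrameInner B)
    (hN : S.IsFrameSum N M) (h1 : S.ClassicalDecomposability) {Φ : A →ₗ[ℝ] A}
    (hΦ : ∀ x ∈ S.cone, Φ x ∈ S.cone) (hΦu : ∀ x, S.unit (Φ x) = S.unit x)
    (hΦs : ∀ x y, B (Φ x) y = B x (Φ y)) {w : A} {n m : ℕ} {p : Fin n → ℝ} {v : Fin n → A}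
    {q : Fin m → ℝ} {x : Fin m → A} (hw : S.IsClassicalDecomposition w p v)
    (hw' : S.IsClassicalDecomposition (Φ w) q x) :
    ∑ j, (p j).negMulLog ≤ ∑ j, (q j).negMulLog := by
  obtain ⟨p', V, hV, hp⟩ := hw.extend hN
  obtain ⟨q', X, hX, hq⟩ := hw'.extend hN
  rw [← hp _ Real.negMulLog_zero, ← hq _ Real.negMulLog_zero]
  have hone {Y : Fin N → A} (hY : S.IsFrame Y) (k : Fin N) : S.unit (Y k) = 1 :=
    S.unit_state (hY.1 k).1
  have hcone {Y : Fin N → A} (hY : S.IsFrame Y) (k : Fin N) : Y k ∈ S.cone :=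
    S.states_subset_cone (hY.1 k).1
  have hnonneg (i k : Fin N) : 0 ≤ B (X i) (Φ (V k)) :=
    hB.nonneg hN h1 (hcone hX.2.2.1 i) (hΦ _ (hcone hV.2.2.1 k))
  -- Symmetry moves `Φ` onto `X i`; then `∑ k, V k = M` represents the unit. Columns need no
  -- symmetry.
  have hrow (i : Fin N) : ∑ k, B (X i) (Φ (V k)) = 1 := by
    simp_rw [← hΦs]
    rw [← map_sum, hN.sum_eq V hV.2.2.1, hB.symm, hB.apply_unit hN h1, hΦu, hone hX.2.2.1]
  have hcol (k : Fin N) : ∑ i, B (X i) (Φ (V k)) = 1 := by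
    rw [← LinearMap.sum_apply, ← map_sum, hN.sum_eq X hX.2.2.1, hB.apply_unit hN h1, hΦu,
      hone hV.2.2.1]
  have hqp (i : Fin N) : q' i = ∑ k, B (X i) (Φ (V k)) * p' k := by
    rw [← hB.apply_frame_sum hX.2.2.1 q' i, ← hX.2.2.2, hB.symm, hV.2.2.2]
    simp only [map_sum, map_smul, smul_eq_mul, mul_comm]
  -- Column sums insert the matrix; Jensen's inequality is then applied in each row.
  calc ∑ k, (p' k).negMulLog = ∑ k, (∑ i, B (X i) (Φ (V k))) * (p' k).negMulLog := by
        simp only [hcol, one_mul]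
    _ = ∑ i, ∑ k, B (X i) (Φ (V k)) * (p' k).negMulLog := by
        simp only [Finset.sum_mul]
        exact Finset.sum_comm
    _ ≤ ∑ i, (q' i).negMulLog := by
        refine Finset.sum_le_sum fun i _ => ?_
        rw [hqp i]
        exact Real.concaveOn_negMulLog.le_map_sum (fun k _ => hnonneg i k) (hrow i)
          fun k _ => hV.1 k

/-- Monotonicity under the identity map, used in both directions between two decompositions of `w`.
-/
theorem IsFrameInner.hasEntropy [FiniteDimensional ℝ A] (hB : S.IsFrameInner B)
    (hN : S.IsFrameSum N M) (h1 : S.ClassicalDecomposability) {w : A} {n : ℕ} {p : Fin n → ℝ}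
    {v : Fin n → A} (hw : S.IsClassicalDecomposition w p v) :
    S.HasEntropy w (∑ j, (p j).negMulLog) := by
  refine ⟨⟨n, p, v, hw⟩, fun m q x hx => ?_⟩
  have hid {k l : ℕ} {r : Fin k → ℝ} {y : Fin k → A} {s : Fin l → ℝ} {z : Fin l → A}
      (hy : S.IsClassicalDecomposition w r y) (hz : S.IsClassicalDecomposition w s z) :=
    hB.sum_negMulLog_le hN h1 (Φ := LinearMap.id) (fun _ h => h) (fun _ => rfl)
      (fun _ _ => rfl) hy hz
  rw [← (hid hx hw).antisymm (hid hw hx)]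
  simp [Real.negMulLog]

end FrameInner

end DynamicalStateSpace

end GPT

/-- Second law for (possibly degenerate) projective measurements. -/
theorem mainTheorem4 {A : Type*} [NormedAddCommGroup A] [NormedSpace ℝ A] [FiniteDimensional ℝ A]
    (S : GPT.DynamicalStateSpace A)
    (h1 : S.ClassicalDecomposability) (h2 : S.StrongSymmetry) :
    (∃ B : LinearMap.BilinForm ℝ A, S.IsSelfDualizing B) ∧
    ∀ B : LinearMap.BilinForm ℝ A, S.IsSelfDualizing B →
      ∀ (m : ℕ) (F : Fin m → Set A) (P : Fin m → A →ₗ[ℝ] A),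
        (∀ a, GPT.IsFace S.cone (F a)) →
        (∀ a, GPT.IsSymmetricProjectorOnto B (P a) (Submodule.span ℝ (F a))) →
        S.IsOperation P →
        ∀ w ∈ S.states,
          (∑ a, P a w) ∈ S.states ∧
          ∃ s s' : ℝ, S.HasEntropy w s ∧ S.HasEntropy (∑ a, P a w) s' ∧ s ≤ s' := by
  obtain ⟨b, hb⟩ := S.exists_isInvariantInner
  obtain ⟨μ, hμ, hfix⟩ := GPT.DynamicalStateSpace.exists_fixed_state hb
  obtain ⟨N, hpos, hN⟩ := GPT.DynamicalStateSpace.exists_isFrameSum h1 h2 hμ hfix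
  refine ⟨?_, fun B hB m F P _ hP hop w hw => ?_⟩
  · obtain ⟨B, hB, hinv⟩ := hb.exists_isFrameInner h1 h2 hμ hfix hpos hN
    exact ⟨B, hB.isSelfDualizing hinv hN h1⟩
  · have hΦ : ∀ x ∈ S.cone, (∑ a, P a) x ∈ S.cone := fun x hx => by
      rw [LinearMap.sum_apply]
      exact S.sum_mem_cone _ fun a _ => (hop.1 a).1 x hx
    have hΦu (x : A) : S.unit ((∑ a, P a) x) = S.unit x := by
      simpa using LinearMap.congr_fun hop.2 x
    have hΦs (x y : A) : B ((∑ a, P a) x) y = B x ((∑ a, P a) y) := by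
      simp [(hP _).2.1]
    have hw' : (∑ a, P a) w ∈ S.states :=
      S.mem_states_of_unit (hΦ w (S.states_subset_cone hw)) ((hΦu w).trans (S.unit_state hw))
    rw [← LinearMap.sum_apply]
    obtain ⟨n, p, v, hv⟩ := h1 w hw
    obtain ⟨k, q, x, hx⟩ := h1 _ hw'
    have hBf := hB.isFrameInner
    exact ⟨hw', _, _, hBf.hasEntropy hN h1 hv, hBf.hasEntropy hN h1 hx,
      hBf.sum_negMulLog_le hN h1 hΦ hΦu hΦs hv hx⟩
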